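/- An MV-algebra is an Abelian monoid $(A,\oplus,0)$ with an involution $\neg$ such that $\neg 0\oplus x=\neg 0$ and $\neg(\neg x\oplus y)\oplus y=\neg(\neg y\oplus x)\oplus x$ for all $x,y$; put $x\le y$ iff $\neg x\oplus y=\neg 0$. The interval $[0,1]$ is an MV-algebra under $x\oplus y=\min\{x+y,1\}$, $\neg x=1-x$, and for $n\ge 2$, $\text{Ł}_n=\{0,\frac1{n-1},\dots,\frac{n-2}{n-1},1\}$ is a subalgebra of it. An ideal is a nonempty subset closed under $\oplus$ and downward closed; a maximal ideal is a maximal proper ideal; an ideal is principal if it is generated by one element. An MV-algebra is profinite if it is isomorphic to the inverse limit, in the category of MV-algebras, of an inverse system of finite MV-algebras indexed by a directed poset. A homomorphism $\varphi:A\to B$ reflects principal maximal ideals if $\varphi^{-1}(M)$ is a principal maximal ideal of $A$ for every principal maximal ideal $M$ of $B$. Let $\mathbb{P}$ be the category of profinite MV-algebras and homomorphisms that reflect principal maximal ideals. Let $\mathbb{M}$ be the category of multisets: its objects are pairs $\langle X,\sigma\rangle$ of a set $X$ and a map $\sigma$ from $X$ to the positive integers, and its morphisms $\langle X,\sigma\rangle\to\langle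 Y,\mu\rangle$ are the maps $\varphi:X\to Y$ such that $\mu(\varphi(x))$ divides $\sigma(x)$ for all $x\in X$. Then $\mathbb{M}$ is dually equivalent to $\mathbb{P}$. More precisely: (1) For a profinite MV-algebra $A$ let $\mathcal{H}_F(A)$ be the set of homomorphisms $\chi:A\to[0,1]$ whose kernel $\{a:\chi(a)=0\}$ is a principal (maximal) ideal of $A$, and put $\sigma_A(\chi)=\#\chi(A)-1$. Each $\chi(A)$ is finite and $\sigma_A(\chi)\geq 1$, and $\mathcal{H}(A)=\langle\mathcal{H}_F(A),\sigma_A\rangle$, $\mathcal{H}(\varphi)(\chi)=\chi\circ\varphi$ defines a functor $\mathcal{H}:\mathbb{P}^{op}\to\mathbb{M}$. (2) $\mathcal{F}(\langle X,\sigma\rangle)=\prod_{x\in X}\text{Ł}_{\sigma(x)+1}$, $\mathcal{F}(\varphi)(f)(x)=f(\varphi(x))$ defines a functor $\mathcal{F}:\mathbb{M}\to\mathbb{P}^{op}$. (3) There are natural isomorphisms $\eta:\mathrm{Id}_{\mathbb{M}}\to\mathcal{H}\circ\mathcal{F}$, with $\eta_X(x)(f)=f(x)$, and $\varepsilon:\mathcal{F}\circ\mathcal{H}\to\mathrm{Id}_{\mathbb{P}^{op}}$,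 whose component at $A$ is the homomorphism $\varepsilon_A:A\to\prod_{\chi\in\mathcal{H}_F(A)}\text{Ł}_{\#\chi(A)}$ with $\varepsilon_A(a)(\chi)=\chi(a)$. They satisfy the triangle identities, so that $\mathcal{F}$, $\mathcal{H}$, $\eta$, $\varepsilon$ form an equivalence between $\mathbb{M}$ and $\mathbb{P}^{op}$ with unit $\eta$ and counit $\varepsilon$. -/

import Mathlib

open CategoryTheory CategoryTheory.Limits

universe u v w

/-! ### MV-algebras, homomorphisms, ideals -/

/-- An MV-algebra: an Abelian monoid `(A, ⊕, 0)` with an involution `¬` such that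
`¬0 ⊕ x = ¬0` and `¬(¬x ⊕ y) ⊕ y = ¬(¬y ⊕ x) ⊕ x`. -/
class MVAlgebra (A : Type u) where
  oplus : A → A → A
  zero : A
  neg : A → A
  oplus_assoc : ∀ x y z, oplus (oplus x y) z = oplus x (oplus y z)
  oplus_comm : ∀ x y, oplus x y = oplus y x
  oplus_zero : ∀ x, oplus x zero = x
  neg_neg : ∀ x, neg (neg x) = x
  neg_zero_oplus : ∀ x, oplus (neg zero) x = neg zero
  luk : ∀ x y, oplus (neg (oplus (neg x) y)) y = oplus (neg (oplus (neg y) x)) x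

namespace MVAlgebra

variable {A : Type u} {B : Type v} {C : Type w} [MVAlgebra A] [MVAlgebra B] [MVAlgebra C]

/-- `x ≤ y` iff `¬x ⊕ y = 1`, where `1 = ¬0`. -/
def le (x y : A) : Prop := oplus (neg x) y = neg zero

variable (A B) in
/-- Homomorphisms of MV-algebras. -/
@[ext]
structure Hom where
  toFun : A → B
  map_zero : toFun zero = zero
  map_oplus : ∀ x y, toFun (oplus x y) = oplus (toFun x) (toFun y)
  map_neg : ∀ x, toFun (neg x) = neg (toFun x)

instance : CoeFun (Hom A B) (fun _ => A → B) := ⟨Hom.toFun⟩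

variable (A) in
/-- The identity homomorphism. -/
def Hom.id : Hom A A := ⟨fun a => a, rfl, fun _ _ => rfl, fun _ => rfl⟩

/-- The composite `g ∘ f`. -/
def Hom.comp (g : Hom B C) (f : Hom A B) : Hom A C where
  toFun a := g (f a)
  map_zero := by rw [f.map_zero, g.map_zero]
  map_oplus x y := by rw [f.map_oplus, g.map_oplus]
  map_neg x := by rw [f.map_neg, g.map_neg]

/-- Ideals: nonempty, closed under `⊕`, downward closed. -/
structure IsIdeal (I : Set A) : Prop where
  nonempty : I.Nonempty
  oplus_mem : ∀ x ∈ I, ∀ y ∈ I, oplus x y ∈ I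
  mem_of_le : ∀ x, ∀ y ∈ I, le x y → x ∈ I

/-- Maximal ideals: maximal among the proper ideals. -/
structure IsMaximalIdeal (M : Set A) : Prop where
  isIdeal : IsIdeal M
  ne_univ : M ≠ Set.univ
  eq_of_subset : ∀ J : Set A, IsIdeal J → J ≠ Set.univ → M ⊆ J → M = J

/-- The ideal generated by `a`: the intersection of all ideals containing `a`. -/
def idealSpan (a : A) : Set A := {x | ∀ J : Set A, IsIdeal J → a ∈ J → x ∈ J}

/-- Principal ideals: the ideals generated by a single element. -/
def IsPrincipalIdeal (I : Set A) : Prop := ∃ a : A, I = idealSpan a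

/-- Principal maximal ideals. -/
def IsPrincipalMaximal (M : Set A) : Prop := IsMaximalIdeal M ∧ IsPrincipalIdeal M

/-- The kernel of a homomorphism. -/
def Hom.ker (f : Hom A B) : Set A := {a | f a = zero}

/-- `f : A → B` reflects principal maximal ideals: the preimage of every principal maximal
ideal of `B` is a principal maximal ideal of `A`. -/
def Hom.ReflectsPrincipalMaximal (f : Hom A B) : Prop :=
  ∀ M : Set B, IsPrincipalMaximal M → IsPrincipalMaximal (f ⁻¹' M)

/-- Subalgebras of an MV-algebra. -/
structure Subalg (A : Type u) [MVAlgebra A] where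
  carrier : Set A
  zero_mem : zero ∈ carrier
  oplus_mem : ∀ x ∈ carrier, ∀ y ∈ carrier, oplus x y ∈ carrier
  neg_mem : ∀ x ∈ carrier, neg x ∈ carrier

instance : CoeSort (Subalg A) (Type u) := ⟨fun S => S.carrier⟩

instance (S : Subalg A) : MVAlgebra S where
  oplus x y := ⟨oplus x.1 y.1, S.oplus_mem _ x.2 _ y.2⟩
  zero := ⟨zero, S.zero_mem⟩
  neg x := ⟨neg x.1, S.neg_mem _ x.2⟩
  oplus_assoc _ _ _ := Subtype.ext (oplus_assoc _ _ _)
  oplus_comm _ _ := Subtype.ext (oplus_comm _ _)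
  oplus_zero _ := Subtype.ext (oplus_zero _)
  neg_neg _ := Subtype.ext (neg_neg _)
  neg_zero_oplus _ := Subtype.ext (neg_zero_oplus _)
  luk _ _ := Subtype.ext (luk _ _)

/-- Direct products, with pointwise operations. -/
instance {X : Type v} (L : X → Type w) [∀ x, MVAlgebra (L x)] : MVAlgebra (∀ x, L x) where
  oplus f g x := oplus (f x) (g x)
  zero _ := zero
  neg f x := neg (f x)
  oplus_assoc _ _ _ := funext fun _ => oplus_assoc _ _ _
  oplus_comm _ _ := funext fun _ => oplus_comm _ _
  oplus_zero _ := funext fun _ => oplus_zero _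
  neg_neg _ := funext fun _ => neg_neg _
  neg_zero_oplus _ := funext fun _ => neg_zero_oplus _
  luk _ _ := funext fun _ => luk _ _

/-- The standard MV-algebra `[0,1]`: `x ⊕ y = min (x + y) 1` and `¬x = 1 - x`. -/
noncomputable instance : MVAlgebra unitInterval where
  oplus x y := ⟨min ((x : ℝ) + y) 1,
    le_min (add_nonneg x.2.1 y.2.1) zero_le_one, min_le_right _ _⟩
  zero := 0
  neg x := ⟨1 - (x : ℝ), sub_nonneg.2 x.2.2, sub_le_self _ x.2.1⟩
  oplus_assoc x y z := by
    apply Subtype.ext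
    have hx := x.2.1
    have hz := z.2.1
    simp only [min_def]
    split_ifs <;> linarith
  oplus_comm x y := by
    apply Subtype.ext
    simp only [add_comm]
  oplus_zero x := by
    apply Subtype.ext
    simpa using x.2.2
  neg_neg x := by
    apply Subtype.ext
    simp
  neg_zero_oplus x := by
    apply Subtype.ext
    simpa using x.2.1
  luk x y := by
    apply Subtype.ext
    have hx := x.2.1
    have hy := y.2.1
    have hx' := x.2.2
    have hy' := y.2.2
    simp only [min_def]
    split_ifs <;> linarith

/-- The Łukasiewicz chain with `n ≥ 2` elements `0, 1/(n-1), …, (n-2)/(n-1), 1`,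
a subalgebra of `[0,1]`. -/
noncomputable def lukChain (n : ℕ) (hn : 2 ≤ n) : Subalg unitInterval where
  carrier := {t | ∃ k : ℕ, k < n ∧ (t : ℝ) = k / ((n : ℝ) - 1)}
  zero_mem := ⟨0, by omega, by simp [MVAlgebra.zero]⟩
  oplus_mem := by
    rintro x ⟨k, hk, hx⟩ y ⟨l, hl, hy⟩
    have hn' : (0 : ℝ) < (n : ℝ) - 1 := by
      have : (2 : ℝ) ≤ n := by exact_mod_cast hn
      linarith
    refine ⟨min (k + l) (n - 1), by omega, ?_⟩
    change min ((x : ℝ) + y) 1 = _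
    rw [hx, hy, ← add_div, Nat.cast_min, Nat.cast_sub (by omega), ← min_div_div_right hn'.le]
    simp [div_self hn'.ne']
  neg_mem := by
    rintro x ⟨k, hk, hx⟩
    have hn' : (0 : ℝ) < (n : ℝ) - 1 := by
      have : (2 : ℝ) ≤ n := by exact_mod_cast hn
      linarith
    refine ⟨n - 1 - k, by omega, ?_⟩
    change 1 - (x : ℝ) = _
    rw [hx, Nat.cast_sub (by omega), Nat.cast_sub (by omega), sub_div, Nat.cast_one,
      div_self hn'.ne']

end MVAlgebra

/-! ### The category of MV-algebras and profinite MV-algebras -/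

open MVAlgebra

/-- Bundled MV-algebras. -/
structure MVCat : Type (u + 1) where
  carrier : Type u
  [str : MVAlgebra carrier]

attribute [instance] MVCat.str

instance : CoeSort MVCat.{u} (Type u) := ⟨MVCat.carrier⟩

/-- The category of all MV-algebras and all homomorphisms. -/
instance : Category MVCat.{u} where
  Hom A B := MVAlgebra.Hom A B
  id A := MVAlgebra.Hom.id A
  comp f g := g.comp f

/-- `A` is profinite: it is isomorphic to the limit, in the category of MV-algebras, of an
inverse system of finite MV-algebras indexed by a directed poset. -/
def IsProfiniteMV (A : MVCat.{u}) : Prop :=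
  ∃ (I : Type u) (_ : PartialOrder I) (_ : IsDirectedOrder I) (D : Iᵒᵖ ⥤ MVCat.{u})
    (c : Cone D), (∀ i, Finite (D.obj i)) ∧ Nonempty (IsLimit c) ∧ Nonempty (A ≅ c.pt)

/-- Objects of `ℙ`: profinite MV-algebras. -/
structure ProfMV : Type (u + 1) where
  toMV : MVCat.{u}
  profinite : IsProfiniteMV toMV

instance : CoeSort ProfMV.{u} (Type u) := ⟨fun A => A.toMV⟩

/-- Morphisms of `ℙ`: homomorphisms that reflect principal maximal ideals. -/
@[ext]
structure ProfMV.Hom (A B : ProfMV.{u}) where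
  hom : MVAlgebra.Hom A B
  reflects : hom.ReflectsPrincipalMaximal

/-- The category `ℙ`. -/
instance : Category ProfMV.{u} where
  Hom A B := ProfMV.Hom A B
  id A := ⟨MVAlgebra.Hom.id A, fun _ h => h⟩
  comp f g := ⟨g.hom.comp f.hom, fun M h => f.reflects _ (g.reflects M h)⟩

/-! ### The category of multisets -/

/-- Objects of `𝕄`: a set `X` with a map `σ` from `X` to the positive integers. -/
structure MultisetCat : Type (u + 1) where
  carrier : Type u
  mult : carrier → ℕ
  mult_pos : ∀ x, 0 < mult x

instance : CoeSort MultisetCat.{u} (Type u) := ⟨MultisetCat.carrier⟩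

/-- Morphisms `⟨X, σ⟩ → ⟨Y, μ⟩` of `𝕄`: maps `φ` such that `μ (φ x)` divides `σ x`. -/
@[ext]
structure MultisetCat.Hom (X Y : MultisetCat.{u}) where
  toFun : X → Y
  dvd : ∀ x, Y.mult (toFun x) ∣ X.mult x

/-- The category `𝕄`. -/
instance : Category MultisetCat.{u} where
  Hom X Y := MultisetCat.Hom X Y
  id X := ⟨fun x => x, fun _ => dvd_rfl⟩
  comp f g := ⟨fun x => g.toFun (f.toFun x), fun x => (g.dvd _).trans (f.dvd x)⟩

/-! ### The functor `ℋ` -/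

/-- The set of homomorphisms `χ : A → [0,1]` whose kernel is a principal maximal ideal. -/
def HF (A : ProfMV.{u}) : Type u :=
  {χ : MVAlgebra.Hom A unitInterval // IsPrincipalMaximal χ.ker}

/-- `σ_A(χ) = #χ(A) - 1`. -/
noncomputable def sigmaHF (A : ProfMV.{u}) (χ : HF A) : ℕ := (Set.range χ.1).ncard - 1

/-- `χ ↦ χ ∘ φ`. -/
noncomputable def HF.precomp {A B : ProfMV.{u}} (φ : B ⟶ A) (χ : HF A) : HF B :=
  ⟨χ.1.comp φ.hom, φ.reflects χ.1.ker χ.2⟩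

/-- The functor `ℋ : ℙᵒᵖ ⥤ 𝕄`, with `ℋ(A) = ⟨HF A, σ_A⟩` and `ℋ(φ)(χ) = χ ∘ φ`, given that
the `σ_A` are well defined maps into the positive integers and that the `ℋ(φ)` are morphisms
of `𝕄`. -/
noncomputable def functorH
    (hσ : ∀ (A : ProfMV.{u}) (χ : HF A), (Set.range χ.1).Finite ∧ 0 < sigmaHF A χ)
    (hdvd : ∀ (A B : ProfMV.{u}) (φ : B ⟶ A) (χ : HF A),
      sigmaHF B (HF.precomp φ χ) ∣ sigmaHF A χ) :
    ProfMV.{u}ᵒᵖ ⥤ MultisetCat.{u} where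
  obj A := ⟨HF A.unop, sigmaHF A.unop, fun χ => (hσ A.unop χ).2⟩
  map {A B} φ := ⟨HF.precomp φ.unop, hdvd A.unop B.unop φ.unop⟩

/-! ### The functor `ℱ` -/

/-- The chain `Ł_{σ(x)+1}`. -/
noncomputable abbrev MultisetCat.chain (X : MultisetCat.{u}) (x : X) : Subalg unitInterval :=
  lukChain (X.mult x + 1) (Nat.succ_le_succ (X.mult_pos x))

/-- The MV-algebra `A_{X,σ} = ∏ x, Ł_{σ(x)+1}`. -/
noncomputable def MultisetCat.prodMV (X : MultisetCat.{u}) : MVCat.{u} :=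
  ⟨∀ x : X, X.chain x⟩

theorem MultisetCat.chain_subset {X Y : MultisetCat.{u}} (φ : X ⟶ Y) (x : X) :
    (Y.chain (φ.toFun x)).carrier ⊆ (X.chain x).carrier := by
  rintro t ⟨k, hk, ht⟩
  obtain ⟨d, hd⟩ := φ.dvd x
  have hX := X.mult_pos x
  have hd0 : 0 < d := Nat.pos_of_ne_zero (by rintro rfl; simp at hd; omega)
  refine ⟨k * d, ?_, ?_⟩
  · rw [hd]
    exact Nat.lt_succ_of_le (Nat.mul_le_mul_right d (Nat.le_of_lt_succ hk))
  · have hd' : (d : ℝ) ≠ 0 := by exact_mod_cast hd0.ne'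
    rw [ht, hd]
    push_cast
    simp only [add_sub_cancel_right]
    rw [mul_div_mul_right _ _ hd']

/-- The homomorphism `A_{Y,μ} → A_{X,σ}`, `f ↦ (x ↦ f (φ x))`. -/
noncomputable def MultisetCat.pullback {X Y : MultisetCat.{u}} (φ : X ⟶ Y) :
    MVAlgebra.Hom Y.prodMV X.prodMV where
  toFun f x := ⟨(f (φ.toFun x)).1, MultisetCat.chain_subset φ x (f (φ.toFun x)).2⟩
  map_zero := rfl
  map_oplus _ _ := rfl
  map_neg _ := rfl

/-- The functor `ℱ : 𝕄 ⥤ ℙᵒᵖ`, with `ℱ⟨X, σ⟩ = A_{X,σ}` and `ℱ(φ)(f)(x) = f (φ x)`, given that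
the `A_{X,σ}` are profinite and that the `ℱ(φ)` reflect principal maximal ideals. -/
noncomputable def functorF
    (hprof : ∀ X : MultisetCat.{u}, IsProfiniteMV X.prodMV)
    (hrefl : ∀ (X Y : MultisetCat.{u}) (φ : X ⟶ Y),
      (MultisetCat.pullback φ).ReflectsPrincipalMaximal) :
    MultisetCat.{u} ⥤ ProfMV.{u}ᵒᵖ where
  obj X := Opposite.op ⟨X.prodMV, hprof X⟩
  map {X Y} φ := Quiver.Hom.op (V := ProfMV.{u}) ⟨MultisetCat.pullback φ, hrefl X Y φ⟩

/-! Multiples of an atom `u` of a finite MV-algebra behave like an initial segment of `ℕ`, and the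
normalised number of copies of `u` below `x` is a homomorphism into `[0,1]` that does not vanish at
`u`. Hence the homomorphisms into `[0,1]` separate the points of a finite MV-algebra. Two distinct
homomorphisms into `[0,1]` can be separated completely, with values `0` and `1`, by iterating
`x ⊕ x` and `x ⊙ x`; so by the Chinese remainder theorem a finite MV-algebra is the product of its
images under the homomorphisms into `[0,1]`. These images are finite chains, and in the limit a
profinite MV-algebra becomes a product of finite chains as well.

A principal maximal ideal of a product of chains is the kernel of a projection: if its generator `a`
vanished nowhere, an element of size `√a` would generate a strictly larger proper ideal. So `η` is
bijective. The counit is invertible on `ℱ X` by the triangle identity, and on an arbitrary profinite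
`A` by naturality along an isomorphism `A ≅ ℱ X`. -/

namespace MVAlgebra

/-! ### The ordered monoid underlying an MV-algebra -/

section Order

variable {A : Type u} {B : Type v} [MVAlgebra A] [MVAlgebra B]

theorem zero_oplus (x : A) : oplus zero x = x := by
  rw [oplus_comm, oplus_zero]

theorem neg_oplus_self (x : A) : oplus (neg x) x = neg zero := by
  have h := luk x (neg zero)
  rw [oplus_comm _ (neg zero), neg_zero_oplus, MVAlgebra.neg_neg, zero_oplus] at h
  exact h.symm

theorem le_neg_zero (x : A) : le x (neg zero) := by
  rw [le, oplus_comm, neg_zero_oplus]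

theorem le_iff_exists_oplus {x y : A} : le x y ↔ ∃ c, y = oplus x c := by
  constructor
  · intro h
    have hluk := luk x y
    rw [show oplus (neg x) y = neg zero from h, MVAlgebra.neg_neg, zero_oplus] at hluk
    exact ⟨_, hluk.trans (oplus_comm _ _)⟩
  · rintro ⟨c, rfl⟩
    rw [le, ← oplus_assoc, neg_oplus_self, neg_zero_oplus]

/-- The additive monoid `(A, ⊕, 0)`. Like the order and the subtraction below it is an instance
only locally, since `[0,1]` and products already carry such structures. -/
abbrev toAddCommMonoid : AddCommMonoid A where
  add := oplus
  zero := zero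
  add_assoc := oplus_assoc
  zero_add := zero_oplus
  add_zero := oplus_zero
  add_comm := oplus_comm
  nsmul := @nsmulRec A ⟨zero⟩ ⟨oplus⟩

/-- The natural order of an MV-algebra. -/
abbrev toPartialOrder : PartialOrder A where
  le := le
  le_refl := neg_oplus_self
  le_trans x y z hxy hyz := by
    obtain ⟨c, rfl⟩ := le_iff_exists_oplus.1 hxy
    obtain ⟨d, rfl⟩ := le_iff_exists_oplus.1 hyz
    exact le_iff_exists_oplus.2 ⟨_, oplus_assoc _ _ _⟩
  le_antisymm x y hxy hyx := by
    have hluk := luk x y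
    rw [show oplus (neg x) y = neg zero from hxy, show oplus (neg y) x = neg zero from hyx,
      MVAlgebra.neg_neg, zero_oplus, zero_oplus] at hluk
    exact hluk.symm

/-- The truncated difference `x ⊖ y = ¬(¬x ⊕ y)`. The Łukasiewicz product `x ⊙ y` is
`x - neg y` in this notation. -/
abbrev toSub : Sub A := ⟨fun x y => neg (oplus (neg x) y)⟩

attribute [local instance] toAddCommMonoid toPartialOrder toSub

/-- `0` as the least element, so that atoms of `A` are Mathlib's `IsAtom`. -/
abbrev toOrderBot : OrderBot A where
  bot := zero
  bot_le := neg_zero_oplus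

theorem canonicallyOrderedAdd : CanonicallyOrderedAdd A where
  exists_add_of_le h := le_iff_exists_oplus.1 h
  le_add_self _ y := le_iff_exists_oplus.2 ⟨y, oplus_comm _ _⟩
  le_self_add _ y := le_iff_exists_oplus.2 ⟨y, rfl⟩

theorem isOrderedAddMonoid : IsOrderedAddMonoid A where
  add_le_add_left x y h z := by
    obtain ⟨c, rfl⟩ := le_iff_exists_oplus.1 h
    exact le_iff_exists_oplus.2 ⟨c, add_right_comm x c z⟩

theorem orderedSub : OrderedSub A where
  tsub_le_iff_right x y z := by
    change oplus (neg (neg (oplus (neg x) y))) z = neg zero ↔ oplus (neg x) (oplus z y) = neg zero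
    rw [MVAlgebra.neg_neg, oplus_assoc, oplus_comm y z]

attribute [local instance] toOrderBot canonicallyOrderedAdd isOrderedAddMonoid orderedSub

theorem neg_add_eq_neg_sub (x y : A) : neg (x + y) = neg x - y :=
  congrArg (fun z => neg (oplus z y)) (MVAlgebra.neg_neg x).symm

theorem neg_sub_neg (x y : A) : neg x - neg y = y - x := by
  rw [← neg_add_eq_neg_sub, add_comm]
  rfl

theorem sub_sub_self_comm (x y : A) : x - (x - y) = y - (y - x) := by
  have h := congrArg neg (luk (neg x) (neg y))
  change neg (_ - neg y + neg y) = neg (_ - neg x + neg x) at h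
  simp only [add_comm _ (neg _), neg_add_eq_neg_sub, MVAlgebra.neg_neg, neg_sub_neg] at h
  exact h.symm

theorem sub_sub_sub_self (x y : A) : x - (x - (x - y)) = x - y := by
  rw [sub_sub_self_comm x (x - y), tsub_eq_zero_of_le (tsub_le_self : x - y ≤ x), tsub_zero]

/-- Below an idempotent `e` the lattice meet `e - (e - x)` is the Łukasiewicz product `e ⊙ x`. -/
theorem sub_sub_self_eq_sub_neg {e : A} (he : e + e = e) (x : A) : e - (e - x) = e - neg x := by
  apply le_antisymm
  · have hself : e ≤ e - neg e := by
      have hneg : neg e - e = neg e := by rw [← neg_add_eq_neg_sub, he]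
      rw [← tsub_eq_zero_iff_le, sub_sub_self_comm, hneg, tsub_self]
    rw [tsub_le_iff_right]
    calc e ≤ e - neg e := hself
      _ ≤ (e - neg x) + (neg x - neg e) := tsub_le_tsub_add_tsub
      _ = (e - neg x) + (e - x) := by rw [neg_sub_neg]
  · refine tsub_le_tsub_left (tsub_le_iff_right.2 ?_) e
    exact (show e ≤ neg zero from le_neg_zero e).trans_eq (neg_oplus_self x).symm

/-! ### Multiples of an atom -/

theorem sub_eq_self_of_isAtom {u r : A} (hu : IsAtom u) (h : ¬ u ≤ r) : r - u = r := by
  rcases hu.le_iff.1 (tsub_le_self : u - (u - r) ≤ u) with hbot | heq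
  · rw [sub_sub_self_comm] at hbot
    exact le_antisymm tsub_le_self (tsub_eq_zero_iff_le.1 hbot)
  · rw [sub_sub_self_comm] at heq
    exact absurd (heq ▸ tsub_le_self) h

theorem sub_nsmul_eq_self {u r : A} (h : r - u = r) (n : ℕ) : r - n • u = r := by
  induction n with
  | zero => rw [zero_nsmul, tsub_zero]
  | succ n ih => rw [succ_nsmul, tsub_add_eq_tsub_tsub, ih, h]

theorem exists_eq_nsmul_of_le_nsmul {u x : A} {n : ℕ} (hu : IsAtom u) (hx : x ≤ n • u) :
    ∃ k ≤ n, x = k • u := by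
  classical
  set k := Nat.findGreatest (fun k => k • u ≤ x) n
  have hkn : k ≤ n := Nat.findGreatest_le n
  have hkx : k • u ≤ x := Nat.findGreatest_spec (P := fun k => k • u ≤ x) (Nat.zero_le n)
    ((zero_nsmul u).trans_le zero_le)
  refine ⟨k, hkn, ?_⟩
  rcases hkn.lt_or_eq with hlt | heq
  · have hremainder : ¬ u ≤ x - k • u := fun h => by
      have hsucc : (k + 1) • u ≤ x := by
        rw [succ_nsmul, add_comm, ← tsub_add_cancel_of_le hkx]
        gcongr
      exact Nat.findGreatest_is_greatest (P := fun k => k • u ≤ x) (Nat.lt_succ_self _) hlt hsucc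
    have hzero : x - k • u = 0 := by
      rw [← sub_nsmul_eq_self (sub_eq_self_of_isAtom hu hremainder) n, tsub_eq_zero_iff_le]
      exact tsub_le_self.trans hx
    exact le_antisymm (tsub_eq_zero_iff_le.1 hzero) hkx
  · exact le_antisymm (heq ▸ hx) hkx

/-- `u` is an atom of (finite) order `n`: its multiples `0, u, …, n • u` are distinct and the
sequence of multiples is constant from `n • u` on. -/
structure IsAtomOfOrder (u : A) (n : ℕ) : Prop where
  isAtom : IsAtom u
  succ_nsmul : (n + 1) • u = n • u
  nsmul_ne : ∀ m < n, (m + 1) • u ≠ m • u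

theorem exists_isAtomOfOrder [Finite A] {u : A} (hu : IsAtom u) : ∃ n, IsAtomOfOrder u n := by
  classical
  have hex : ∃ n : ℕ, (n + 1) • u = n • u := by
    obtain ⟨n, hn⟩ := WellFoundedGT.monotone_chain_condition
      (⟨fun n : ℕ => n • u, fun _ _ h => nsmul_le_nsmul_left zero_le h⟩ : ℕ →o A)
    exact ⟨n, (hn (n + 1) n.le_succ).symm⟩
  exact ⟨Nat.find hex, hu, Nat.find_spec hex, fun _ h => Nat.find_min hex h⟩

namespace IsAtomOfOrder

variable {u : A} {n : ℕ} (h : IsAtomOfOrder u n)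
include h

theorem nsmul_eq_of_le {k : ℕ} (hk : n ≤ k) : k • u = n • u := by
  induction k, hk using Nat.le_induction with
  | base => rfl
  | succ k _ ih => rw [_root_.succ_nsmul, ih, ← _root_.succ_nsmul, h.succ_nsmul]

theorem nsmul_add_nsmul_self : n • u + n • u = n • u := by
  rw [← add_nsmul, h.nsmul_eq_of_le (Nat.le_add_left n n)]

theorem le_of_nsmul_le_nsmul {i j : ℕ} (hi : i ≤ n) (hij : i • u ≤ j • u) : i ≤ j := by
  by_contra! hlt
  refine h.nsmul_ne j (hlt.trans_le hi) (le_antisymm ?_ (nsmul_le_nsmul_left zero_le j.le_succ))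
  exact (nsmul_le_nsmul_left zero_le hlt).trans hij

theorem nsmul_injOn : Set.InjOn (fun k : ℕ => k • u) (Set.Iic n) := fun _ hi _ hj hij =>
  le_antisymm (h.le_of_nsmul_le_nsmul hi hij.le) (h.le_of_nsmul_le_nsmul hj hij.ge)

theorem pos : 0 < n := by
  refine Nat.pos_of_ne_zero ?_
  rintro rfl
  have hsucc := h.succ_nsmul
  rw [zero_add, one_nsmul, zero_nsmul] at hsucc
  exact h.isAtom.1 hsucc

theorem nsmul_sub_nsmul (k : ℕ) : n • u - k • u = (n - k) • u := by
  rcases le_total n k with hk | hk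
  · rw [h.nsmul_eq_of_le hk, tsub_self, Nat.sub_eq_zero_of_le hk, zero_nsmul]
  obtain ⟨j, _, hje⟩ :=
    exists_eq_nsmul_of_le_nsmul h.isAtom (tsub_le_self : n • u - k • u ≤ n • u)
  have hnjk : n ≤ j + k := by
    refine h.le_of_nsmul_le_nsmul le_rfl ?_
    rw [add_nsmul, ← hje, tsub_add_cancel_of_le (nsmul_le_nsmul_left zero_le hk)]
  apply le_antisymm
  · rw [tsub_le_iff_right, ← add_nsmul, Nat.sub_add_cancel hk]
  · rw [hje]
    exact nsmul_le_nsmul_left zero_le (Nat.sub_le_iff_le_add.2 hnjk)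

theorem exists_sub_sub_self_eq_nsmul (x : A) : ∃ k ≤ n, n • u - (n • u - x) = k • u :=
  exists_eq_nsmul_of_le_nsmul h.isAtom tsub_le_self

/-- The number of copies of the atom `u` below `x`, that is, the `k ≤ n` with
`n • u ⊓ x = k • u`. -/
noncomputable def count (x : A) : ℕ := (h.exists_sub_sub_self_eq_nsmul x).choose

theorem count_le (x : A) : h.count x ≤ n := (h.exists_sub_sub_self_eq_nsmul x).choose_spec.1

theorem sub_sub_self_eq_count_nsmul (x : A) : n • u - (n • u - x) = h.count x • u :=
  (h.exists_sub_sub_self_eq_nsmul x).choose_spec.2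

theorem nsmul_sub_count_nsmul (x : A) : n • u - h.count x • u = n • u - x := by
  rw [← h.sub_sub_self_eq_count_nsmul, sub_sub_sub_self]

theorem count_eq {x : A} {k : ℕ} (hk : k ≤ n) (hx : n • u - x = (n - k) • u) :
    h.count x = k := by
  refine h.nsmul_injOn (h.count_le x) hk ?_
  change h.count x • u = k • u
  rw [← h.sub_sub_self_eq_count_nsmul, hx, h.nsmul_sub_nsmul, Nat.sub_sub_self hk]

theorem count_zero : h.count 0 = 0 := h.count_eq n.zero_le (tsub_zero _)

theorem count_add (x y : A) : h.count (x + y) = min (h.count x + h.count y) n := by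
  refine h.count_eq (min_le_right _ _) ?_
  calc n • u - (x + y)
      = n • u - y - h.count x • u := by
        rw [tsub_add_eq_tsub_tsub, ← h.nsmul_sub_count_nsmul x, tsub_right_comm]
    _ = n • u - (h.count x + h.count y) • u := by
        rw [← h.nsmul_sub_count_nsmul y, ← tsub_add_eq_tsub_tsub, ← add_nsmul, add_comm]
    _ = (n - min (h.count x + h.count y) n) • u := by
        rw [h.nsmul_sub_nsmul]
        congr 1
        omega

theorem count_neg (x : A) : h.count (neg x) = n - h.count x := by
  refine h.count_eq (Nat.sub_le _ _) ?_
  rw [← sub_sub_self_eq_sub_neg h.nsmul_add_nsmul_self, h.sub_sub_self_eq_count_nsmul,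
    Nat.sub_sub_self (h.count_le x)]

theorem count_ne_zero {x : A} (hux : u ≤ x) : h.count x ≠ 0 := fun h0 => by
  have hle : n • u ≤ (n - 1) • u :=
    calc n • u = n • u - x := by rw [← h.nsmul_sub_count_nsmul, h0, zero_nsmul, tsub_zero]
      _ ≤ n • u - 1 • u := tsub_le_tsub_left ((one_nsmul u).trans_le hux) _
      _ = (n - 1) • u := h.nsmul_sub_nsmul 1
  have hn := h.le_of_nsmul_le_nsmul le_rfl hle
  have hpos := h.pos
  omega

/-- The homomorphism into `[0,1]` attached to an atom of order `n`: the normalised count of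
copies of the atom. -/
noncomputable def countHom : Hom A unitInterval where
  toFun x := ⟨h.count x / n, by positivity,
    div_le_one_of_le₀ (by exact_mod_cast h.count_le x) n.cast_nonneg⟩
  map_zero := Subtype.ext <| by
    change (h.count 0 : ℝ) / n = 0
    rw [h.count_zero, Nat.cast_zero, zero_div]
  map_oplus x y := Subtype.ext <| by
    change (h.count (x + y) : ℝ) / n = min ((h.count x : ℝ) / n + h.count y / n) 1
    have hn : (0 : ℝ) < n := by exact_mod_cast h.pos
    rw [h.count_add, ← add_div, ← div_self hn.ne', min_div_div_right hn.le, Nat.cast_min,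
      Nat.cast_add]
  map_neg x := Subtype.ext <| by
    change (h.count (neg x) : ℝ) / n = 1 - (h.count x : ℝ) / n
    have hn : (n : ℝ) ≠ 0 := by exact_mod_cast h.pos.ne'
    rw [h.count_neg, Nat.cast_sub (h.count_le x), sub_div, div_self hn]

theorem countHom_ne_zero {x : A} (hux : u ≤ x) : h.countHom x ≠ zero := fun h0 => by
  have hdiv : (h.count x : ℝ) / n = 0 := congrArg Subtype.val h0
  rw [div_eq_zero_iff, Nat.cast_eq_zero, Nat.cast_eq_zero] at hdiv
  exact hdiv.elim (h.count_ne_zero hux) h.pos.ne'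

end IsAtomOfOrder

theorem exists_hom_ne_zero [Finite A] {b : A} (hb : b ≠ 0) :
    ∃ χ : Hom A unitInterval, χ b ≠ zero := by
  obtain ⟨u, hu, hub⟩ := (eq_bot_or_exists_atom_le b).resolve_left hb
  obtain ⟨n, hn⟩ := exists_isAtomOfOrder hu
  exact ⟨hn.countHom, hn.countHom_ne_zero hub⟩

/-! ### Homomorphisms into `[0,1]` -/

theorem le_iff_coe_le {s t : unitInterval} : le s t ↔ (s : ℝ) ≤ t := by
  rw [le, Subtype.ext_iff]
  change min (1 - (s : ℝ) + t) 1 = 1 - 0 ↔ _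
  rw [sub_zero, min_eq_right_iff]
  constructor <;> intro h <;> linarith

namespace Hom

theorem map_le (f : Hom A B) {x y : A} (h : le x y) : le (f x) (f y) := by
  rw [le, ← f.map_neg, ← f.map_oplus, show oplus (neg x) y = neg zero from h, f.map_neg,
    f.map_zero]

variable (χ : Hom A unitInterval)

theorem coe_map_zero : (χ zero : ℝ) = 0 := congrArg Subtype.val χ.map_zero

theorem coe_map_neg (x : A) : (χ (neg x) : ℝ) = 1 - χ x := congrArg Subtype.val (χ.map_neg x)

theorem coe_map_neg_zero : (χ (neg zero) : ℝ) = 1 := by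
  rw [coe_map_neg, coe_map_zero, sub_zero]

theorem coe_map_add (x y : A) : (χ (x + y) : ℝ) = min ((χ x : ℝ) + χ y) 1 :=
  congrArg Subtype.val (χ.map_oplus x y)

theorem coe_map_sub (x y : A) : (χ (x - y) : ℝ) = max ((χ x : ℝ) - χ y) 0 := by
  change (χ (neg (neg x + y)) : ℝ) = _
  rw [coe_map_neg, coe_map_add, coe_map_neg, ← max_sub_sub_left, sub_self,
    show (1 : ℝ) - (1 - χ x + χ y) = χ x - χ y by ring]

theorem coe_map_nsmul (n : ℕ) (x : A) : (χ (n • x) : ℝ) = min (n * (χ x : ℝ)) 1 := by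
  induction n with
  | zero =>
    rw [zero_nsmul, Nat.cast_zero, zero_mul, min_eq_left zero_le_one]
    exact χ.coe_map_zero
  | succ n ih =>
    rw [succ_nsmul, coe_map_add, ih, ← min_add_add_right, min_assoc,
      min_eq_right (by linarith [(χ x).2.1] : (1 : ℝ) ≤ 1 + χ x), Nat.cast_succ, add_one_mul]

theorem coe_map_nsmul_of_le {n : ℕ} {x : A} (h : n * (χ x : ℝ) ≤ 1) :
    (χ (n • x) : ℝ) = n * χ x := by
  rw [coe_map_nsmul, min_eq_left h]

theorem mem_ker {x : A} : x ∈ χ.ker ↔ (χ x : ℝ) = 0 := Subtype.ext_iff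

/-- For `t = χ a` the multiple `⌈1/√t⌉₊ • t` lies between `√t` and `√t + t`. -/
theorem exists_sqrt_le_map_le {a : A} (ha : 0 < (χ a : ℝ)) :
    ∃ b, √(χ a : ℝ) ≤ χ b ∧ (χ b : ℝ) ≤ 2 * √(χ a : ℝ) := by
  refine ⟨⌈1 / √(χ a : ℝ)⌉₊ • a, ?_⟩
  rw [coe_map_nsmul]
  set t : ℝ := (χ a : ℝ)
  set n := ⌈1 / √t⌉₊
  have ht : 0 < √t := Real.sqrt_pos.2 ha
  have ht1 : √t ≤ 1 := Real.sqrt_le_one.2 (χ a).2.2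
  have hlow : 1 ≤ n * √t := (div_le_iff₀ ht).1 (Nat.le_ceil _)
  have hupp : n * √t ≤ 1 + √t :=
    calc n * √t ≤ (1 / √t + 1) * √t := by
          gcongr
          exact (Nat.ceil_lt_add_one (by positivity)).le
      _ = 1 + √t := by rw [add_mul, one_div_mul_cancel ht.ne', one_mul]
  have hsq : n * t = n * √t * √t := by rw [mul_assoc, Real.mul_self_sqrt ha.le]
  rw [hsq]
  constructor
  · exact le_min (le_mul_of_one_le_left ht.le hlow) ht1
  · calc min (n * √t * √t) 1 ≤ n * √t * √t := min_le_left _ _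
      _ ≤ (1 + √t) * √t := by gcongr
      _ ≤ 2 * √t := by gcongr; linarith

variable {χ} {ψ : Hom A unitInterval}

/-- Where `χ` and `ψ` lie on opposite sides of `1/2`, a multiple of `x ⊙ x` separates them;
otherwise `x ⊕ x` or `x ⊙ x` doubles the gap. -/
theorem exists_map_eq_zero_map_eq_one_of_one_le_mul (N : ℕ) (x : A)
    (hgap : 1 ≤ 2 ^ N * ((ψ x : ℝ) - χ x)) : ∃ a, (χ a : ℝ) = 0 ∧ (ψ a : ℝ) = 1 := by
  induction N generalizing x with
  | zero =>
    rw [pow_zero, one_mul] at hgap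
    exact ⟨x, by linarith [(χ x).2.1, (ψ x).2.2], by linarith [(χ x).2.1, (ψ x).2.2]⟩
  | succ N ih =>
    have hlt : (χ x : ℝ) < ψ x := by
      by_contra! hle
      exact hgap.not_gt ((mul_nonpos_of_nonneg_of_nonpos (by positivity)
        (sub_nonpos.2 hle)).trans_lt one_pos)
    rw [pow_succ, mul_assoc] at hgap
    rcases le_or_gt (ψ x : ℝ) (1 / 2) with hψ | hψ
    · refine ih (x + x) ?_
      rw [coe_map_add, coe_map_add, min_eq_left (by linarith), min_eq_left (by linarith)]
      convert hgap using 2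
      ring
    rcases le_or_gt (1 / 2) (χ x : ℝ) with hχ | hχ
    · refine ih (x - neg x) ?_
      rw [coe_map_sub, coe_map_sub, coe_map_neg, coe_map_neg, max_eq_left (by linarith),
        max_eq_left (by linarith)]
      convert hgap using 2
      ring
    · have hχ0 : (χ (x - neg x) : ℝ) = 0 := by
        rw [coe_map_sub, coe_map_neg, max_eq_right (by linarith)]
      have hψ0 : 0 < (ψ (x - neg x) : ℝ) := by
        rw [coe_map_sub, coe_map_neg]
        exact lt_max_of_lt_left (by linarith)
      obtain ⟨n, hn⟩ := exists_nat_ge (1 / (ψ (x - neg x) : ℝ))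
      refine ⟨n • (x - neg x), ?_, ?_⟩
      · rw [coe_map_nsmul, hχ0, mul_zero, min_eq_left zero_le_one]
      · rw [coe_map_nsmul, min_eq_right ((div_le_iff₀ hψ0).1 hn)]

theorem exists_map_eq_zero_map_eq_one (h : χ ≠ ψ) : ∃ a, (χ a : ℝ) = 0 ∧ (ψ a : ℝ) = 1 := by
  obtain ⟨x, hx⟩ : ∃ x, (χ x : ℝ) < ψ x := by
    by_contra! hle
    refine h (Hom.ext (funext fun x => Subtype.ext (le_antisymm ?_ (hle x))))
    have hneg := hle (neg x)
    rw [coe_map_neg, coe_map_neg] at hneg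
    linarith
  obtain ⟨N, hN⟩ := pow_unbounded_of_one_lt (1 / ((ψ x : ℝ) - χ x)) one_lt_two
  exact exists_map_eq_zero_map_eq_one_of_one_le_mul N x ((div_le_iff₀ (sub_pos.2 hx)).1 hN.le)

theorem eq_of_ker_subset (h : χ.ker ⊆ ψ.ker) : χ = ψ := by
  by_contra hne
  obtain ⟨a, hχ, hψ⟩ := exists_map_eq_zero_map_eq_one hne
  exact one_ne_zero (hψ.symm.trans (ψ.mem_ker.1 (h (χ.mem_ker.2 hχ))))

theorem exists_map_eq_one_forall_map_eq_zero (S : Finset (Hom A unitInterval)) (hψ : ψ ∉ S) :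
    ∃ e, (ψ e : ℝ) = 1 ∧ ∀ χ ∈ S, (χ e : ℝ) = 0 := by
  classical
  induction S using Finset.induction_on with
  | empty => exact ⟨neg zero, ψ.coe_map_neg_zero, by simp⟩
  | insert χ S _ ih =>
    rw [Finset.mem_insert, not_or] at hψ
    obtain ⟨e, hψe, hSe⟩ := ih hψ.2
    obtain ⟨a, hχa, hψa⟩ := exists_map_eq_zero_map_eq_one (Ne.symm hψ.1)
    refine ⟨e - neg a, ?_, (Finset.forall_mem_insert _ _ _).2 ⟨?_, fun φ hφ => ?_⟩⟩
    · rw [coe_map_sub, coe_map_neg, hψe, hψa, sub_self, sub_zero, max_eq_left zero_le_one]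
    · rw [coe_map_sub, coe_map_neg, hχa, sub_zero, max_eq_right (sub_nonpos.2 (χ e).2.2)]
    · rw [coe_map_sub, hSe φ hφ, zero_sub, max_eq_right (neg_nonpos.2 (φ (neg a)).2.1)]

/-- The Chinese remainder theorem for the kernels of the homomorphisms into `[0,1]`. -/
theorem exists_forall_map_eq (S : Finset (Hom A unitInterval)) (d : Hom A unitInterval → A) :
    ∃ a, ∀ χ ∈ S, χ a = χ (d χ) := by
  classical
  induction S using Finset.induction_on with
  | empty => exact ⟨zero, by simp⟩
  | insert ψ S hψ ih =>
    obtain ⟨a, ha⟩ := ih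
    obtain ⟨e, hψe, hSe⟩ := exists_map_eq_one_forall_map_eq_zero S hψ
    refine ⟨(d ψ - neg e) + (a - e), (Finset.forall_mem_insert _ _ _).2
      ⟨Subtype.ext ?_, fun χ hχ => Subtype.ext ?_⟩⟩ <;>
      rw [coe_map_add, coe_map_sub, coe_map_sub, coe_map_neg]
    · rw [hψe, sub_self, sub_zero, max_eq_left (ψ (d ψ)).2.1,
        max_eq_right (sub_nonpos.2 (ψ a).2.2), add_zero, min_eq_left (ψ (d ψ)).2.2]
    · rw [hSe χ hχ, sub_zero, sub_zero, max_eq_right (sub_nonpos.2 (χ (d ψ)).2.2),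
        max_eq_left (χ a).2.1, zero_add, min_eq_left (χ a).2.2, ha χ hχ]

end Hom

theorem finite_hom_unitInterval [Finite A] : Finite (Hom A unitInterval) :=
  Finite.of_injective Hom.ker fun _ _ h => Hom.eq_of_ker_subset h.subset

theorem eq_of_forall_hom_eq [Finite A] {x y : A} (h : ∀ χ : Hom A unitInterval, χ x = χ y) :
    x = y := by
  have hle : ∀ {x y : A}, (∀ χ : Hom A unitInterval, χ x = χ y) → x ≤ y := fun h => by
    rw [← tsub_eq_zero_iff_le]
    by_contra hne
    obtain ⟨χ, hχ⟩ := exists_hom_ne_zero hne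
    exact hχ (Subtype.ext (by rw [χ.coe_map_sub, h, sub_self, max_self]; rfl))
  exact le_antisymm (hle h) (hle fun χ => (h χ).symm)

theorem exists_forall_hom_eq [Finite A] {v : Hom A unitInterval → unitInterval}
    (hv : ∀ χ : Hom A unitInterval, v χ ∈ Set.range χ) :
    ∃ a, ∀ χ : Hom A unitInterval, χ a = v χ := by
  have := finite_hom_unitInterval (A := A)
  have := Fintype.ofFinite (Hom A unitInterval)
  choose d hd using hv
  obtain ⟨a, ha⟩ := Hom.exists_forall_map_eq Finset.univ d
  exact ⟨a, fun χ => (ha χ (Finset.mem_univ χ)).trans (hd χ)⟩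

/-! ### Łukasiewicz chains -/

theorem mem_lukChain_succ {m : ℕ} {h : 2 ≤ m + 1} {t : unitInterval} :
    t ∈ (lukChain (m + 1) h).carrier ↔ ∃ k ≤ m, (t : ℝ) = k / m := by
  simp only [lukChain, Set.mem_ofPred_eq, Nat.cast_succ, add_sub_cancel_right, Nat.lt_succ_iff]

theorem ncard_lukChain (n : ℕ) (h : 2 ≤ n) : (lukChain n h).carrier.ncard = n := by
  have hn : (n : ℝ) - 1 ≠ 0 := sub_ne_zero.2 (by exact_mod_cast (by omega : n ≠ 1))
  have hle : ∀ k < n, (k : ℝ) / (n - 1) ≤ 1 := fun k hk => by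
    have hkn : (k : ℝ) + 1 ≤ n := by exact_mod_cast hk
    exact div_le_one_of_le₀ (by linarith) (by linarith [k.cast_nonneg (α := ℝ)])
  have himage : Subtype.val '' (lukChain n h).carrier =
      (fun k : ℕ => (k : ℝ) / (n - 1)) '' Finset.range n := by
    ext t
    constructor
    · rintro ⟨s, ⟨k, hk, hs⟩, rfl⟩
      exact ⟨k, Finset.mem_coe.2 (Finset.mem_range.2 hk), hs.symm⟩
    · rintro ⟨k, hk, rfl⟩
      have hkn := Finset.mem_range.1 (Finset.mem_coe.1 hk)
      have hn1 : (1 : ℝ) ≤ n := by exact_mod_cast (by omega : 1 ≤ n)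
      exact ⟨⟨_, div_nonneg k.cast_nonneg (sub_nonneg.2 hn1), hle k hkn⟩, ⟨k, hkn, rfl⟩, rfl⟩
  have hinj : Function.Injective fun k : ℕ => (k : ℝ) / (n - 1) := fun k l hkl =>
    Nat.cast_injective ((div_left_inj' hn).1 hkl)
  rw [← Set.ncard_image_of_injective _ Subtype.val_injective, himage,
    Set.ncard_image_of_injective _ hinj, Set.ncard_coe_finset, Finset.card_range]

theorem finite_lukChain (n : ℕ) (h : 2 ≤ n) : (lukChain n h).carrier.Finite :=
  Set.finite_of_ncard_ne_zero (by rw [ncard_lukChain]; omega)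

theorem dvd_of_lukChain_subset {m n : ℕ} {hm : 2 ≤ m + 1} {hn : 2 ≤ n + 1}
    (h : (lukChain (m + 1) hm).carrier ⊆ (lukChain (n + 1) hn).carrier) : m ∣ n := by
  have hm1 : (1 : ℝ) ≤ m := by exact_mod_cast (by omega : 1 ≤ m)
  have hn0 : (n : ℝ) ≠ 0 := by exact_mod_cast (by omega : n ≠ 0)
  let t : unitInterval := ⟨1 / m, by positivity, div_le_one_of_le₀ hm1 (by positivity)⟩
  have ht : t ∈ (lukChain (m + 1) hm).carrier :=
    mem_lukChain_succ.2 ⟨1, by omega, by rw [Nat.cast_one]⟩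
  obtain ⟨k, _, hk⟩ := mem_lukChain_succ.1 (h ht)
  refine ⟨k, ?_⟩
  change (1 : ℝ) / m = k / n at hk
  rw [div_eq_div_iff (by positivity) hn0, one_mul] at hk
  rw [mul_comm]
  exact_mod_cast hk

namespace Hom

variable {χ : Hom A unitInterval}

theorem exists_eq_natCast_mul {a : A} (ha : 0 < (χ a : ℝ))
    (hmin : ∀ y, 0 < (χ y : ℝ) → (χ a : ℝ) ≤ χ y) (x : A) :
    ∃ k : ℕ, (χ x : ℝ) = k * χ a := by
  set k := ⌊(χ x : ℝ) / χ a⌋₊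
  have hk : (k : ℝ) * χ a ≤ χ x :=
    (le_div_iff₀ ha).1 (Nat.floor_le (div_nonneg (χ x).2.1 ha.le))
  have hk' : (χ x : ℝ) < (k + 1) * χ a := (div_lt_iff₀ ha).1 (Nat.lt_floor_add_one _)
  have hremainder : (χ (x - k • a) : ℝ) = χ x - k * χ a := by
    rw [coe_map_sub, coe_map_nsmul_of_le _ (hk.trans (χ x).2.2), max_eq_left (sub_nonneg.2 hk)]
  refine ⟨k, le_antisymm (not_lt.1 fun hlt => ?_) hk⟩
  have hle := hmin (x - k • a) (by rw [hremainder]; linarith)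
  rw [hremainder] at hle
  linarith

theorem exists_range_eq_lukChain (h : (Set.range χ).Finite) :
    ∃ (m : ℕ) (hm : 2 ≤ m + 1), Set.range χ = (lukChain (m + 1) hm).carrier := by
  obtain ⟨_, ⟨⟨a, rfl⟩, ha⟩, hmin⟩ := Set.exists_min_image {t ∈ Set.range χ | 0 < (t : ℝ)}
    Subtype.val (h.sep _) ⟨_, ⟨neg zero, rfl⟩, χ.coe_map_neg_zero.symm ▸ one_pos⟩
  have hmul := exists_eq_natCast_mul ha fun y hy => hmin _ ⟨⟨y, rfl⟩, hy⟩
  obtain ⟨m, hm⟩ := hmul (neg zero)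
  rw [coe_map_neg_zero] at hm
  have hm0 : 0 < m := Nat.pos_of_ne_zero (by rintro rfl; norm_num at hm)
  have hm0' : (0 : ℝ) < m := by exact_mod_cast hm0
  have ha_eq : (χ a : ℝ) = 1 / m := by rw [eq_div_iff hm0'.ne', mul_comm, hm]
  refine ⟨m, by omega, Set.Subset.antisymm ?_ fun t ht => ?_⟩
  · rintro _ ⟨x, rfl⟩
    obtain ⟨k, hk⟩ := hmul x
    rw [ha_eq, mul_one_div] at hk
    refine mem_lukChain_succ.2 ⟨k, ?_, hk⟩
    have hle := (χ x).2.2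
    rw [hk, div_le_one hm0'] at hle
    exact_mod_cast hle
  · obtain ⟨k, -, hk⟩ := mem_lukChain_succ.1 ht
    refine ⟨k • a, Subtype.ext ?_⟩
    rw [← mul_one_div, ← ha_eq] at hk
    rw [hk, coe_map_nsmul_of_le _ (hk ▸ t.2.2)]

theorem ncard_range_sub_one_pos (h : (Set.range χ).Finite) : 0 < (Set.range χ).ncard - 1 := by
  obtain ⟨m, hm, hrange⟩ := exists_range_eq_lukChain h
  rw [hrange, ncard_lukChain]
  omega

theorem range_eq_lukChain (h : (Set.range χ).Finite) :
    Set.range χ = (lukChain ((Set.range χ).ncard - 1 + 1)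
      (Nat.succ_le_succ (ncard_range_sub_one_pos h))).carrier := by
  obtain ⟨m, hm, hrange⟩ := exists_range_eq_lukChain h
  have hcard : (Set.range χ).ncard - 1 = m := by rw [hrange, ncard_lukChain, Nat.add_sub_cancel]
  subst hcard
  exact hrange

end Hom

/-! ### Ideals -/

theorem mem_idealSpan_self (a : A) : a ∈ idealSpan a := fun _ _ h => h

namespace IsIdeal

variable {I : Set A} (hI : IsIdeal I)
include hI

theorem zero_mem : zero ∈ I :=
  let ⟨y, hy⟩ := hI.nonempty
  hI.mem_of_le _ y hy (neg_zero_oplus y)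

theorem nsmul_mem {a : A} (ha : a ∈ I) (n : ℕ) : n • a ∈ I := by
  induction n with
  | zero => exact hI.zero_mem
  | succ n ih => exact succ_nsmul a n ▸ hI.oplus_mem _ ih _ ha

theorem eq_univ (h : neg zero ∈ I) : I = Set.univ :=
  Set.eq_univ_of_forall fun x => hI.mem_of_le x _ h (le_neg_zero x)

theorem idealSpan_subset {a : A} (ha : a ∈ I) : idealSpan a ⊆ I := fun _ hx => hx I hI ha

end IsIdeal

theorem IsIdeal.preimage {I : Set B} (hI : IsIdeal I) (f : Hom A B) : IsIdeal (f ⁻¹' I) where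
  nonempty := ⟨zero, by rw [Set.mem_preimage, f.map_zero]; exact hI.zero_mem⟩
  oplus_mem x hx y hy := by
    rw [Set.mem_preimage, f.map_oplus]
    exact hI.oplus_mem _ hx _ hy
  mem_of_le x y hy h := hI.mem_of_le _ _ hy (f.map_le h)

theorem isIdeal_idealSpan (a : A) : IsIdeal (idealSpan a) where
  nonempty := ⟨a, mem_idealSpan_self a⟩
  oplus_mem x hx y hy J hJ ha := hJ.oplus_mem x (hx J hJ ha) y (hy J hJ ha)
  mem_of_le x y hy h J hJ ha := hJ.mem_of_le x y (hy J hJ ha) h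

theorem mem_idealSpan_iff {a x : A} : x ∈ idealSpan a ↔ ∃ n : ℕ, x ≤ n • a := by
  constructor
  · intro hx
    refine hx {y | ∃ n : ℕ, y ≤ n • a} ⟨⟨0, 0, zero_le⟩, ?_, ?_⟩ ⟨1, (one_nsmul a).ge⟩
    · rintro x ⟨m, hm⟩ y ⟨n, hn⟩
      exact ⟨m + n, (add_le_add hm hn).trans_eq (add_nsmul a m n).symm⟩
    · rintro x y ⟨n, hn⟩ hxy
      exact ⟨n, le_trans hxy hn⟩
  · rintro ⟨n, hn⟩ J hJ ha
    exact hJ.mem_of_le x _ (hJ.nsmul_mem ha n) hn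

section Inverse

variable {f : Hom A B} {g : Hom B A}

theorem preimage_idealSpan_of_inverse (hgf : Function.LeftInverse g f)
    (hfg : Function.RightInverse g f) (b : B) : f ⁻¹' idealSpan b = idealSpan (g b) := by
  apply Set.Subset.antisymm
  · intro x hx J hJ hb
    rw [← hgf x]
    exact hx _ (hJ.preimage g) hb
  · refine ((isIdeal_idealSpan b).preimage f).idealSpan_subset ?_
    rw [Set.mem_preimage, hfg]
    exact mem_idealSpan_self b

theorem IsMaximalIdeal.preimage_of_inverse (hgf : Function.LeftInverse g f)
    (hfg : Function.RightInverse g f) {M : Set B} (hM : IsMaximalIdeal M) :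
    IsMaximalIdeal (f ⁻¹' M) where
  isIdeal := hM.isIdeal.preimage f
  ne_univ h := hM.ne_univ <| by rw [← hfg.preimage_preimage M, h, Set.preimage_univ]
  eq_of_subset J hJ hJ_ne hMJ := by
    have hne : g ⁻¹' J ≠ Set.univ := fun h =>
      hJ_ne (by rw [← hgf.preimage_preimage J, h, Set.preimage_univ])
    rw [hM.eq_of_subset _ (hJ.preimage g) hne, hgf.preimage_preimage]
    rw [← hfg.preimage_preimage M]
    exact Set.preimage_mono hMJ

theorem reflectsPrincipalMaximal_of_inverse (hgf : Function.LeftInverse g f)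
    (hfg : Function.RightInverse g f) : f.ReflectsPrincipalMaximal := by
  rintro _ ⟨hM, b, rfl⟩
  exact ⟨hM.preimage_of_inverse hgf hfg, g b, preimage_idealSpan_of_inverse hgf hfg b⟩

end Inverse

theorem Hom.isIdeal_ker (χ : Hom A unitInterval) : IsIdeal χ.ker where
  nonempty := ⟨zero, χ.map_zero⟩
  oplus_mem x hx y hy := by
    rw [mem_ker] at hx hy ⊢
    exact (χ.coe_map_add x y).trans (by rw [hx, hy, add_zero, min_eq_left zero_le_one])
  mem_of_le x y hy h := by
    rw [mem_ker] at hy ⊢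
    exact le_antisymm (hy ▸ le_iff_coe_le.1 (χ.map_le h)) (χ x).2.1

/-- An ideal containing `χ.ker` and some `a` with `χ a > 0` also contains some `n • a` with
`χ (n • a) = 1` and the element `¬(n • a)` of `χ.ker`. -/
theorem Hom.isMaximalIdeal_ker (χ : Hom A unitInterval) : IsMaximalIdeal χ.ker where
  isIdeal := χ.isIdeal_ker
  ne_univ h := by
    have hone := χ.mem_ker.1 (Set.eq_univ_iff_forall.1 h (neg zero))
    rw [coe_map_neg_zero] at hone
    exact one_ne_zero hone
  eq_of_subset J hJ hJ_ne hsub := by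
    refine Set.Subset.antisymm hsub fun a ha => ?_
    by_contra hker
    have hpos : (0 : ℝ) < χ a := (χ a).2.1.lt_of_ne' fun h0 => hker (χ.mem_ker.2 h0)
    obtain ⟨n, hn⟩ := exists_nat_ge (1 / (χ a : ℝ))
    have hneg : neg (n • a) ∈ J := hsub <| χ.mem_ker.2 <| by
      rw [coe_map_neg, coe_map_nsmul, min_eq_right ((div_le_iff₀ hpos).1 hn), sub_self]
    refine hJ_ne (hJ.eq_univ ?_)
    rw [← neg_oplus_self (n • a)]
    exact hJ.oplus_mem _ hneg _ (hJ.nsmul_mem ha n)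

/-! ### Products of subalgebras of `[0,1]` -/

variable {X : Type v}

/-- The evaluation `f ↦ f x` of a product of subalgebras of `[0,1]`. -/
noncomputable def piEval (S : X → Subalg unitInterval) (x : X) :
    Hom (∀ x, S x) unitInterval where
  toFun f := (f x).1
  map_zero := rfl
  map_oplus _ _ := rfl
  map_neg _ := rfl

variable {S : X → Subalg unitInterval}

theorem le_pi_iff {f g : ∀ x, S x} :
    le f g ↔ ∀ x, (piEval S x f : ℝ) ≤ piEval S x g := by
  constructor
  · exact fun h x => le_iff_coe_le.1 ((piEval S x).map_le h)
  · exact fun h => funext fun x => Subtype.ext (le_iff_coe_le.2 (h x))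

theorem range_piEval (x : X) : Set.range (piEval S x) = (S x).carrier := by
  classical
  apply Set.Subset.antisymm
  · rintro _ ⟨f, rfl⟩
    exact (f x).2
  · intro t ht
    let f : ∀ y, S y := Function.update zero x ⟨t, ht⟩
    exact ⟨f, congrArg Subtype.val (Function.update_self x _ _ : f x = ⟨t, ht⟩)⟩

open Classical in
/-- The function that is `0` at `x` and `1` elsewhere; it generates the kernel of the evaluation
at `x`. -/
noncomputable def coatom (S : X → Subalg unitInterval) (x : X) : ∀ y, S y :=
  Function.update (neg zero) x zero

theorem piEval_coatom_self (x : X) : (piEval S x (coatom S x) : ℝ) = 0 := by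
  classical
  have hzero : coatom S x x = zero := Function.update_self x _ _
  exact congrArg (fun t : S x => (t.1 : ℝ)) hzero

theorem piEval_coatom_of_ne {x y : X} (h : y ≠ x) : (piEval S y (coatom S x) : ℝ) = 1 := by
  classical
  have hone : coatom S x y = neg zero := Function.update_of_ne h _ _
  exact (congrArg (fun t : S y => (t.1 : ℝ)) hone).trans (sub_zero 1)

theorem piEval_injective : Function.Injective (piEval S) := fun x y h => by
  by_contra hne
  have hone : (piEval S x (coatom S y) : ℝ) = 1 := piEval_coatom_of_ne hne
  rw [h, piEval_coatom_self] at hone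
  exact zero_ne_one hone

theorem ker_piEval_eq_idealSpan (x : X) : (piEval S x).ker = idealSpan (coatom S x) := by
  apply Set.Subset.antisymm
  · intro f hf J hJ hJx
    refine hJ.mem_of_le f _ hJx (le_pi_iff.2 fun y => ?_)
    rcases eq_or_ne y x with rfl | hne
    · rw [(piEval S y).mem_ker.1 hf, piEval_coatom_self]
    · rw [piEval_coatom_of_ne hne]
      exact (piEval S y f).2.2
  · exact (piEval S x).isIdeal_ker.idealSpan_subset
      ((piEval S x).mem_ker.2 (piEval_coatom_self x))

theorem isPrincipalMaximal_ker_piEval (x : X) : IsPrincipalMaximal (piEval S x).ker :=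
  ⟨(piEval S x).isMaximalIdeal_ker, coatom S x, ker_piEval_eq_idealSpan x⟩

theorem mem_idealSpan_pi_iff {f a : ∀ x, S x} :
    f ∈ idealSpan a ↔ ∃ k : ℕ, ∀ x, (piEval S x f : ℝ) ≤ k * piEval S x a := by
  rw [mem_idealSpan_iff]
  refine exists_congr fun k => le_pi_iff.trans (forall_congr' fun x => ?_)
  rw [Hom.coe_map_nsmul, le_min_iff, and_iff_left (piEval S x f).2.2]

theorem idealSpan_pi_eq_univ_iff {a : ∀ x, S x} :
    idealSpan a = Set.univ ↔ ∃ k : ℕ, ∀ x, 1 ≤ k * (piEval S x a : ℝ) := by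
  have hone : neg zero ∈ idealSpan a ↔ ∃ k : ℕ, ∀ x, 1 ≤ k * (piEval S x a : ℝ) := by
    simp only [mem_idealSpan_pi_iff, Hom.coe_map_neg_zero]
  exact ⟨fun h => hone.1 (h ▸ Set.mem_univ _),
    fun h => (isIdeal_idealSpan a).eq_univ (hone.2 h)⟩

theorem exists_sqrt_le_piEval_le {a : ∀ x, S x} (ha : ∀ x, 0 < (piEval S x a : ℝ)) :
    ∃ b : ∀ x, S x, ∀ x, √(piEval S x a : ℝ) ≤ piEval S x b ∧
      (piEval S x b : ℝ) ≤ 2 * √(piEval S x a : ℝ) := by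
  choose b hb using fun x => (piEval S x).exists_sqrt_le_map_le (ha x)
  exact ⟨fun x => b x x, hb⟩

/-- If the generator `a` vanished nowhere, then an element `b` of size `√a` would generate a
proper ideal that is strictly larger. -/
theorem exists_piEval_eq_zero {a : ∀ x, S x} (hmax : IsMaximalIdeal (idealSpan a)) :
    ∃ x, (piEval S x a : ℝ) = 0 := by
  by_contra! hne
  have hpos : ∀ x, 0 < (piEval S x a : ℝ) := fun x => (piEval S x a).2.1.lt_of_ne' (hne x)
  have hsq : ∀ x, √(piEval S x a : ℝ) * √(piEval S x a : ℝ) = piEval S x a := fun x =>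
    Real.mul_self_sqrt (hpos x).le
  have hunbounded : ¬ ∃ k : ℕ, ∀ x, 1 ≤ k * √(piEval S x a : ℝ) := by
    rintro ⟨k, hk⟩
    refine hmax.ne_univ (idealSpan_pi_eq_univ_iff.2 ⟨k * k, fun x => ?_⟩)
    rw [← hsq, Nat.cast_mul, mul_mul_mul_comm]
    exact one_le_mul_of_one_le_of_one_le (hk x) (hk x)
  obtain ⟨b, hb⟩ := exists_sqrt_le_piEval_le hpos
  have hb_proper : idealSpan b ≠ Set.univ := fun huniv => by
    obtain ⟨k, hk⟩ := idealSpan_pi_eq_univ_iff.1 huniv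
    refine hunbounded ⟨k * 2, fun x => (hk x).trans ?_⟩
    rw [Nat.cast_mul, Nat.cast_two, mul_assoc]
    exact mul_le_mul_of_nonneg_left (hb x).2 k.cast_nonneg
  have ha_mem : a ∈ idealSpan b := mem_idealSpan_pi_iff.2 ⟨1, fun x => by
    rw [Nat.cast_one, one_mul]
    refine le_trans ?_ (hb x).1
    exact Real.le_sqrt_of_sq_le (pow_le_of_le_one (hpos x).le (piEval S x a).2.2 two_ne_zero)⟩
  have hspan := hmax.eq_of_subset _ (isIdeal_idealSpan b) hb_proper
    ((isIdeal_idealSpan b).idealSpan_subset ha_mem)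
  obtain ⟨k, hk⟩ := mem_idealSpan_pi_iff.1 (hspan ▸ mem_idealSpan_self b)
  refine hunbounded ⟨k, fun x => ?_⟩
  refine (le_mul_iff_one_le_left (Real.sqrt_pos.2 (hpos x))).1 ?_
  rw [mul_assoc, hsq]
  exact (hb x).1.trans (hk x)

theorem exists_eq_ker_piEval {M : Set (∀ x, S x)} (hM : IsPrincipalMaximal M) :
    ∃ x, M = (piEval S x).ker := by
  obtain ⟨hmax, a, rfl⟩ := hM
  obtain ⟨x, hx⟩ := exists_piEval_eq_zero hmax
  have hker := (piEval S x).isMaximalIdeal_ker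
  exact ⟨x, hmax.eq_of_subset _ hker.isIdeal hker.ne_univ
    (hker.isIdeal.idealSpan_subset ((piEval S x).mem_ker.2 hx))⟩

theorem exists_piEval_eq {χ : Hom (∀ x, S x) unitInterval} (hχ : IsPrincipalMaximal χ.ker) :
    ∃ x, piEval S x = χ := by
  obtain ⟨x, hx⟩ := exists_eq_ker_piEval hχ
  exact ⟨x, Hom.eq_of_ker_subset hx.ge⟩

end Order

end MVAlgebra

/-! ### Limits of finite MV-algebras -/

namespace MVCat

variable {A B : MVCat.{u}}

/-- A bijective homomorphism as an isomorphism of the category of MV-algebras. -/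
noncomputable def isoOfBijective (f : MVAlgebra.Hom A B) (hf : Function.Bijective f) : A ≅ B where
  hom := f
  inv :=
    { toFun := Function.surjInv hf.2
      map_zero := hf.1 (by rw [Function.surjInv_eq hf.2, f.map_zero])
      map_oplus := fun x y => hf.1 (by simp only [f.map_oplus, Function.surjInv_eq hf.2])
      map_neg := fun x => hf.1 (by simp only [f.map_neg, Function.surjInv_eq hf.2]) }
  hom_inv_id := MVAlgebra.Hom.ext (funext (Function.leftInverse_surjInv hf))
  inv_hom_id := MVAlgebra.Hom.ext (funext (Function.rightInverse_surjInv hf.2))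

theorem leftInverse_inv_hom (e : A ≅ B) : Function.LeftInverse e.inv.toFun e.hom.toFun :=
  congrFun (congrArg MVAlgebra.Hom.toFun e.hom_inv_id)

theorem rightInverse_inv_hom (e : A ≅ B) : Function.RightInverse e.inv.toFun e.hom.toFun :=
  congrFun (congrArg MVAlgebra.Hom.toFun e.inv_hom_id)

variable {J : Type u} [Category.{v} J] (D : J ⥤ MVCat.{u})

/-- The compatible families of a diagram of MV-algebras. -/
def sectionsSubalg : Subalg (∀ j, D.obj j) where
  carrier := {b | ∀ i j (g : i ⟶ j), (D.map g).toFun (b i) = b j}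
  zero_mem _ _ g := (D.map g).map_zero
  oplus_mem x hx y hy i j g := by
    change (D.map g).toFun (oplus (x i) (y i)) = oplus (x j) (y j)
    rw [(D.map g).map_oplus, hx i j g, hy i j g]
  neg_mem x hx i j g := by
    change (D.map g).toFun (neg (x i)) = neg (x j)
    rw [(D.map g).map_neg, hx i j g]

/-- The projection of the compatible families to the component `j`. -/
def sectionsProj (j : J) : MVAlgebra.Hom (sectionsSubalg D) (D.obj j) :=
  ⟨fun b => b.1 j, rfl, fun _ _ => rfl, fun _ => rfl⟩

variable {D} in
theorem map_comp_sectionsProj {i j : J} (g : i ⟶ j) :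
    MVAlgebra.Hom.comp (D.map g) (sectionsProj D i) = sectionsProj D j :=
  MVAlgebra.Hom.ext (funext fun b => b.2 i j g)

/-- The cone of compatible families, the standard limit cone of a diagram of MV-algebras. -/
def sectionsCone : Cone D where
  pt := ⟨sectionsSubalg D⟩
  π := { app := sectionsProj D, naturality := fun _ _ g => (map_comp_sectionsProj g).symm }

/-- The universal property of the cone of compatible families. -/
def isLimitSectionsCone : IsLimit (sectionsCone D) where
  lift s :=
    { toFun := fun a => ⟨fun j => (s.π.app j).toFun a, fun _ _ g =>
        congrFun (congrArg MVAlgebra.Hom.toFun (s.w g)) a⟩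
      map_zero := Subtype.ext (funext fun j => (s.π.app j).map_zero)
      map_oplus := fun _ _ => Subtype.ext (funext fun j => (s.π.app j).map_oplus _ _)
      map_neg := fun _ => Subtype.ext (funext fun j => (s.π.app j).map_neg _) }
  fac _ _ := rfl
  uniq _ _ hm := MVAlgebra.Hom.ext <| funext fun a => Subtype.ext <| funext fun j =>
    congrFun (congrArg MVAlgebra.Hom.toFun (hm j)) a

/-- The homomorphisms from the algebra of compatible families to `[0,1]` that depend on a single
component. -/
def sectionsHoms : Set (MVAlgebra.Hom (sectionsSubalg D) unitInterval) :=
  {χ | ∃ (j : J) (ψ : MVAlgebra.Hom (D.obj j) unitInterval), ψ.comp (sectionsProj D j) = χ}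

variable {D}

theorem finite_range_of_mem_sectionsHoms [∀ j, Finite (D.obj j)]
    {χ : MVAlgebra.Hom (sectionsSubalg D) unitInterval} (hχ : χ ∈ sectionsHoms D) :
    (Set.range χ).Finite := by
  obtain ⟨j, ψ, rfl⟩ := hχ
  exact (Set.finite_range ψ).subset (Set.range_comp_subset_range (sectionsProj D j) ψ)

theorem sections_ext [∀ j, Finite (D.obj j)] {x y : sectionsSubalg D}
    (h : ∀ χ ∈ sectionsHoms D, χ x = χ y) : x = y :=
  Subtype.ext <| funext fun j => eq_of_forall_hom_eq fun ψ => h _ ⟨j, ψ, rfl⟩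

theorem exists_section_forall_eq [∀ j, Finite (D.obj j)]
    {v : MVAlgebra.Hom (sectionsSubalg D) unitInterval → unitInterval}
    (hv : ∀ χ ∈ sectionsHoms D, v χ ∈ Set.range χ) :
    ∃ a, ∀ χ ∈ sectionsHoms D, χ a = v χ := by
  have hcomponent (j : J) : ∃ b : D.obj j, ∀ ψ : MVAlgebra.Hom (D.obj j) unitInterval,
      ψ b = v (ψ.comp (sectionsProj D j)) :=
    exists_forall_hom_eq fun ψ => by
      obtain ⟨a, ha⟩ := hv _ ⟨j, ψ, rfl⟩
      exact ⟨sectionsProj D j a, ha⟩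
  choose b hb using hcomponent
  have hcompatible : b ∈ (sectionsSubalg D).carrier := fun i j g =>
    eq_of_forall_hom_eq fun ψ => by
      rw [hb j ψ, ← map_comp_sectionsProj g]
      exact hb i (ψ.comp (D.map g))
  refine ⟨⟨b, hcompatible⟩, ?_⟩
  rintro _ ⟨j, ψ, rfl⟩
  exact hb j ψ

end MVCat

namespace MultisetCat

variable {A : Type v} [MVAlgebra A] {T : Type u} (χ : T → MVAlgebra.Hom A unitInterval)
  (hχ : ∀ t, (Set.range (χ t)).Finite)

/-- The multiset of a family of homomorphisms into `[0,1]` with finite images, `t` having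
multiplicity `#χ_t(A) - 1`. -/
noncomputable def ofHoms : MultisetCat.{u} :=
  ⟨T, fun t => (Set.range (χ t)).ncard - 1, fun t => Hom.ncard_range_sub_one_pos (hχ t)⟩

/-- The homomorphism `a ↦ (t ↦ χ_t(a))` into the product of the images of a family of
homomorphisms. -/
noncomputable def evalHoms : MVAlgebra.Hom A (ofHoms χ hχ).prodMV where
  toFun a t := ⟨χ t a, (Hom.range_eq_lukChain (hχ t)).subset ⟨a, rfl⟩⟩
  map_zero := funext fun t => Subtype.ext (χ t).map_zero
  map_oplus _ _ := funext fun t => Subtype.ext ((χ t).map_oplus _ _)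
  map_neg _ := funext fun t => Subtype.ext ((χ t).map_neg _)

end MultisetCat

theorem MVCat.exists_iso_prodMV {J : Type u} [Category.{v} J] (D : J ⥤ MVCat.{u})
    [∀ j, Finite (D.obj j)] :
    ∃ X : MultisetCat.{u}, Nonempty ((sectionsCone D).pt ≅ X.prodMV) := by
  classical
  let X := MultisetCat.ofHoms (fun χ : sectionsHoms D => χ.1)
    fun χ => finite_range_of_mem_sectionsHoms χ.2
  let ev : MVAlgebra.Hom (sectionsSubalg D) X.prodMV := MultisetCat.evalHoms _ _
  refine ⟨X, ⟨isoOfBijective (A := (sectionsCone D).pt) ev ⟨fun x y hxy => ?_, fun f => ?_⟩⟩⟩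
  · exact sections_ext fun χ hχ =>
      congrArg (fun f : ∀ χ : X, X.chain χ => (f ⟨χ, hχ⟩).1) hxy
  · let v χ := if h : χ ∈ sectionsHoms D then (f ⟨χ, h⟩).1 else 0
    have hv : ∀ χ : sectionsHoms D, v χ.1 = (f χ).1 := fun χ => dif_pos χ.2
    obtain ⟨a, ha⟩ := exists_section_forall_eq (D := D) (v := v) fun χ hχ =>
      hv ⟨χ, hχ⟩ ▸ (Hom.range_eq_lukChain (finite_range_of_mem_sectionsHoms hχ)).superset
        (f ⟨χ, hχ⟩).2
    exact ⟨a, funext fun χ => Subtype.ext ((ha χ.1 χ.2).trans (hv χ))⟩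

theorem IsProfiniteMV.exists_iso_prodMV {A : MVCat.{u}} (hA : IsProfiniteMV A) :
    ∃ X : MultisetCat.{u}, Nonempty (A ≅ X.prodMV) := by
  obtain ⟨I, _, _, D, c, _, ⟨hc⟩, ⟨e⟩⟩ := hA
  obtain ⟨X, ⟨e'⟩⟩ := MVCat.exists_iso_prodMV D
  exact ⟨X, ⟨e ≪≫ hc.conePointUniqueUpToIso (MVCat.isLimitSectionsCone D) ≪≫ e'⟩⟩

section FiniteSubproducts

variable {X : Type (max u v)} (L : X → Type v) [∀ x, MVAlgebra (L x)]

/-- The inverse system of the finite subproducts of `∏ x, L x`. -/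
def finiteSubproducts : (Finset X)ᵒᵖ ⥤ MVCat.{max u v} where
  obj S := ⟨∀ x : S.unop, L x.1⟩
  map {S T} g :=
    { toFun := fun (f : ∀ x : S.unop, L x.1) (x : T.unop) => f ⟨x.1, g.unop.le x.2⟩
      map_zero := rfl
      map_oplus := fun _ _ => rfl
      map_neg := fun _ => rfl }
  map_id _ := rfl
  map_comp _ _ := rfl

/-- The homomorphism taking `f` to the family of its restrictions to the finite subsets. -/
def toFiniteSubproducts :
    MVAlgebra.Hom (∀ x, L x) (MVCat.sectionsSubalg (finiteSubproducts L)) where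
  toFun f := ⟨fun _ x => f x.1, fun _ _ _ => rfl⟩
  map_zero := rfl
  map_oplus _ _ := rfl
  map_neg _ := rfl

theorem bijective_toFiniteSubproducts : Function.Bijective (toFiniteSubproducts L) := by
  let point (x : X) : ({x} : Finset X) := ⟨x, Finset.mem_singleton_self x⟩
  constructor
  · intro f g hfg
    funext x
    exact congrFun (congrFun (congrArg Subtype.val hfg) (Opposite.op {x})) (point x)
  · intro b
    let component (S : Finset X) : ∀ x : S, L x.1 := b.1 (Opposite.op S)
    refine ⟨fun x => component {x} (point x), Subtype.ext (funext fun S => funext fun x => ?_)⟩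
    have hx : ({x.1} : Finset X) ≤ S.unop := Finset.singleton_subset_iff.2 x.2
    exact (congrFun (b.2 S (Opposite.op {x.1}) (homOfLE hx).op) (point x.1)).symm

theorem isProfiniteMV_pi [∀ x, Finite (L x)] : IsProfiniteMV ⟨∀ x, L x⟩ := by
  classical
  have hfinite (S : (Finset X)ᵒᵖ) : Finite ((finiteSubproducts L).obj S) :=
    inferInstanceAs (Finite (∀ x : S.unop, L x.1))
  exact ⟨Finset X, inferInstance, inferInstance, finiteSubproducts L, MVCat.sectionsCone _,
    hfinite, ⟨MVCat.isLimitSectionsCone _⟩,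
    ⟨MVCat.isoOfBijective (B := (MVCat.sectionsCone (finiteSubproducts L)).pt)
      (toFiniteSubproducts L) (bijective_toFiniteSubproducts L)⟩⟩

end FiniteSubproducts

/-! ### The duality -/

namespace MultisetCat

theorem isProfiniteMV_prodMV (X : MultisetCat.{u}) : IsProfiniteMV X.prodMV := by
  have (x : X) : Finite (X.chain x) := (finite_lukChain _ _).to_subtype
  exact isProfiniteMV_pi.{u, 0} fun x => X.chain x

theorem reflectsPrincipalMaximal_pullback {X Y : MultisetCat.{u}} (φ : X ⟶ Y) :
    (pullback φ).ReflectsPrincipalMaximal := by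
  intro M hM
  obtain ⟨x, rfl⟩ := exists_eq_ker_piEval (S := X.chain) hM
  have hker : pullback φ ⁻¹' (piEval X.chain x).ker = (piEval Y.chain (φ.toFun x)).ker := rfl
  exact hker ▸ isPrincipalMaximal_ker_piEval (S := Y.chain) (φ.toFun x)

/-- A multiplicity preserving bijection as an isomorphism of multisets. -/
noncomputable def isoOfBijective {X Y : MultisetCat.{u}} (f : X → Y) (hf : Function.Bijective f)
    (hmult : ∀ x, Y.mult (f x) = X.mult x) : X ≅ Y where
  hom := ⟨f, fun x => (hmult x).dvd⟩
  inv := ⟨Function.surjInv hf.2, fun y => by rw [← hmult, Function.surjInv_eq hf.2]⟩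
  hom_inv_id := MultisetCat.Hom.ext (funext (Function.leftInverse_surjInv hf))
  inv_hom_id := MultisetCat.Hom.ext (funext (Function.rightInverse_surjInv hf.2))

end MultisetCat

/-- An isomorphism of MV-algebras as an isomorphism of `ℙ`. -/
def ProfMV.isoMk {A B : ProfMV.{u}} (e : A.toMV ≅ B.toMV) : A ≅ B where
  hom := ⟨e.hom, reflectsPrincipalMaximal_of_inverse (MVCat.leftInverse_inv_hom e)
    (MVCat.rightInverse_inv_hom e)⟩
  inv := ⟨e.inv, reflectsPrincipalMaximal_of_inverse (MVCat.rightInverse_inv_hom e)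
    (MVCat.leftInverse_inv_hom e)⟩
  hom_inv_id := ProfMV.Hom.ext e.hom_inv_id
  inv_hom_id := ProfMV.Hom.ext e.inv_hom_id

theorem HF.finite_range {A : ProfMV.{u}} (χ : HF A) : (Set.range χ.1).Finite := by
  obtain ⟨X, ⟨e⟩⟩ := A.profinite.exists_iso_prodMV
  let g : (⟨X.prodMV, X.isProfiniteMV_prodMV⟩ : ProfMV) ⟶ A := (ProfMV.isoMk e.symm).hom
  obtain ⟨x, hx⟩ := exists_piEval_eq (S := X.chain) (HF.precomp g χ).2
  have hrange : Set.range χ.1 = Set.range (piEval X.chain x) := by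
    rw [hx]
    exact ((MVCat.leftInverse_inv_hom e).surjective.range_comp χ.1).symm
  rw [hrange, range_piEval]
  exact finite_lukChain _ _

theorem sigmaHF_pos (A : ProfMV.{u}) (χ : HF A) : 0 < sigmaHF A χ :=
  Hom.ncard_range_sub_one_pos χ.finite_range

theorem HF.range_eq_lukChain {A : ProfMV.{u}} (χ : HF A) :
    Set.range χ.1 = (lukChain (sigmaHF A χ + 1) (Nat.succ_le_succ (sigmaHF_pos A χ))).carrier :=
  Hom.range_eq_lukChain χ.finite_range

theorem sigmaHF_precomp_dvd (A B : ProfMV.{u}) (φ : B ⟶ A) (χ : HF A) :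
    sigmaHF B (HF.precomp φ χ) ∣ sigmaHF A χ :=
  dvd_of_lukChain_subset <| (HF.precomp φ χ).range_eq_lukChain ▸ χ.range_eq_lukChain ▸
    Set.range_comp_subset_range φ.hom χ.1

/-- The functor `ℋ`, with its well-definedness discharged. -/
noncomputable abbrev toMultiset : ProfMV.{u}ᵒᵖ ⥤ MultisetCat.{u} :=
  functorH (fun A χ => ⟨χ.finite_range, sigmaHF_pos A χ⟩) sigmaHF_precomp_dvd

/-- The functor `ℱ`, with its well-definedness discharged. -/
noncomputable abbrev toProfMV : MultisetCat.{u} ⥤ ProfMV.{u}ᵒᵖ :=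
  functorF MultisetCat.isProfiniteMV_prodMV
    fun _ _ φ => MultisetCat.reflectsPrincipalMaximal_pullback φ

/-- The value `η_X(x)` of the unit: the evaluation `f ↦ f x`. -/
noncomputable def MultisetCat.evalHF (X : MultisetCat.{u}) (x : X) : HF (toProfMV.obj X).unop :=
  ⟨piEval X.chain x, isPrincipalMaximal_ker_piEval x⟩

theorem MultisetCat.bijective_evalHF (X : MultisetCat.{u}) : Function.Bijective X.evalHF := by
  refine ⟨fun x y h => piEval_injective (congrArg Subtype.val h), fun χ => ?_⟩
  obtain ⟨x, hx⟩ := exists_piEval_eq (S := X.chain) χ.2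
  exact ⟨x, Subtype.ext hx⟩

theorem MultisetCat.sigmaHF_evalHF (X : MultisetCat.{u}) (x : X) :
    sigmaHF _ (X.evalHF x) = X.mult x := by
  change (Set.range (piEval X.chain x)).ncard - 1 = _
  rw [range_piEval, ncard_lukChain, Nat.add_sub_cancel]

/-- The unit `η`, with `η_X(x)(f) = f(x)`. -/
noncomputable def unitIsoEval : 𝟭 MultisetCat.{u} ≅ toProfMV ⋙ toMultiset :=
  NatIso.ofComponents
    (fun X => MultisetCat.isoOfBijective X.evalHF X.bijective_evalHF X.sigmaHF_evalHF)
    fun _ => rfl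

/-- The homomorphism `ε_A`, with `ε_A(a)(χ) = χ(a)`. -/
noncomputable def evalHom (A : ProfMV.{u}) :
    MVAlgebra.Hom A (toMultiset.obj (Opposite.op A)).prodMV :=
  MultisetCat.evalHoms (fun χ : HF A => χ.1) HF.finite_range

theorem reflectsPrincipalMaximal_evalHom (A : ProfMV.{u}) :
    (evalHom A).ReflectsPrincipalMaximal := by
  intro M hM
  obtain ⟨χ, rfl⟩ :=
    exists_eq_ker_piEval (S := (toMultiset.obj (Opposite.op A)).chain) hM
  exact χ.2

/-- The counit `ε` as a natural transformation. -/
noncomputable def counitEval : toMultiset ⋙ toProfMV ⟶ 𝟭 ProfMV.{u}ᵒᵖ where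
  app A := Quiver.Hom.op (V := ProfMV.{u})
    ⟨evalHom A.unop, reflectsPrincipalMaximal_evalHom A.unop⟩
  naturality _ _ _ := rfl

theorem map_unit_comp_counit (X : MultisetCat.{u}) :
    toProfMV.map (unitIsoEval.hom.app X) ≫ counitEval.app (toProfMV.obj X) =
      𝟙 (toProfMV.obj X) := rfl

/-- By naturality it suffices to consider `A = ℱ X`, where the triangle identity exhibits `ε_A`
as the inverse of `ℱ(η_X)`. -/
theorem isIso_counitEval_app (A : ProfMV.{u}ᵒᵖ) : IsIso (counitEval.app A) := by
  obtain ⟨X, ⟨e⟩⟩ := A.unop.profinite.exists_iso_prodMV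
  let e' : toProfMV.obj X ≅ A := (ProfMV.isoMk (B := (toProfMV.obj X).unop) e).op
  rw [← NatTrans.isIso_app_iff_of_iso counitEval e']
  have : IsIso (toProfMV.map (unitIsoEval.hom.app X) ≫ counitEval.app (toProfMV.obj X)) := by
    rw [map_unit_comp_counit]
    exact IsIso.id (toProfMV.obj X)
  exact IsIso.of_isIso_comp_left (toProfMV.map (unitIsoEval.hom.app X)) _

/-- The counit `ε` as a natural isomorphism. -/
noncomputable def counitIsoEval : toMultiset ⋙ toProfMV ≅ 𝟭 ProfMV.{u}ᵒᵖ :=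
  have := isIso_counitEval_app
  have : IsIso counitEval := NatIso.isIso_of_isIso_app counitEval
  asIso counitEval

theorem corollary4p6 :
    -- `ℋ` and `ℱ` are well defined,
    ∃ (hσ : ∀ (A : ProfMV.{u}) (χ : HF A), (Set.range χ.1).Finite ∧ 0 < sigmaHF A χ)
      (hdvd : ∀ (A B : ProfMV.{u}) (φ : B ⟶ A) (χ : HF A),
        sigmaHF B (HF.precomp φ χ) ∣ sigmaHF A χ)
      (hprof : ∀ X : MultisetCat.{u}, IsProfiniteMV X.prodMV)
      (hrefl : ∀ (X Y : MultisetCat.{u}) (φ : X ⟶ Y),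
        (MultisetCat.pullback φ).ReflectsPrincipalMaximal),
    -- and they form an equivalence `𝕄 ≌ ℙᵒᵖ`,
    ∃ (η : 𝟭 MultisetCat.{u} ≅ functorF hprof hrefl ⋙ functorH hσ hdvd)
      (ε : functorH hσ hdvd ⋙ functorF hprof hrefl ≅ 𝟭 ProfMV.{u}ᵒᵖ)
      (tri : ∀ X : MultisetCat.{u},
        (functorF hprof hrefl).map (η.hom.app X) ≫ ε.hom.app ((functorF hprof hrefl).obj X) =
          𝟙 ((functorF hprof hrefl).obj X)),
    let e : MultisetCat.{u} ≌ ProfMV.{u}ᵒᵖ :=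
      { functor := functorF hprof hrefl
        inverse := functorH hσ hdvd
        unitIso := η
        counitIso := ε
        functor_unitIso_comp := tri }
    -- with unit `η_X(x)(f) = f(x)` and counit given by `ε_A(a)(χ) = χ(a)`.
    (∀ (X : MultisetCat.{u}) (x : X) (f : ∀ x : X, X.chain x),
      ((e.unit.app X).toFun x).1 f = (f x).1) ∧
    (∀ (A : ProfMV.{u}) (a : A) (χ : HF A),
      ((e.counit.app (Opposite.op A)).unop.hom a χ).1 = χ.1 a) := by
  exact ⟨fun A χ => ⟨χ.finite_range, sigmaHF_pos A χ⟩, sigmaHF_precomp_dvd,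
    MultisetCat.isProfiniteMV_prodMV,
    fun _ _ φ => MultisetCat.reflectsPrincipalMaximal_pullback φ,
    unitIsoEval, counitIsoEval, map_unit_comp_counit,
    fun _ _ _ => rfl, fun _ _ _ => rfl⟩
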